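/- All hypergraphs $H=(V(H),E(H))$ with $E(H)\subseteq 2^{V(H)}$ are finite. A *subhypergraph* of $H$ is a hypergraph $H'$ with $E(H')\subseteq E(H)$ and $V(H')=\bigcup E(H')$. For $X\subseteq V(H)$, $H-X$ is the hypergraph with vertex set $V(H)\setminus X$ and edge set $\{e\setminus X\mid e\in E(H)\}\setminus\{\emptyset\}$. A non-empty set $s\subseteq V(H)$ is a *nest-set* of $H$ if $\{e\setminus s\mid e\in E(H),\ e\cap s\neq\emptyset\}$ is linearly ordered by $\subseteq$. A *$k$-NEO* of $H$ is a (possibly empty) finite sequence $(s_1,\dots,s_q)$ of sets with at most $k$ elements such that, with $H_0=H$ and $H_i=H_{i-1}-s_i$, each $s_i$ is a nest-set of $H_{i-1}$, and $H_q$ is the empty hypergraph (no vertices and no edges). The *nest-set width* $\mathrm{nsw}(H)$ is the least $k\in\mathbb N$ for which $H$ has a $k$-NEO ($\infty$ if there is none, which happens only if $V(H)=\emptyset$ and $E(H)=\{\emptyset\}$). A *hypertree decomposition* of $H$ is a finite rooted tree $T$ with a bag $B_u\subseteq V(H)$ and a cover $\lambda_u\subseteq E(H)$ for each node $u$, such that: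 (1) for every $v\in V(H)$ the nodes $u$ with $v\in B_u$ induce a (possibly empty) subtree of $T$; (2) every $e\in E(H)$ is contained in some $B_u$; (3) $B_u\subseteq\bigcup\lambda_u$ for every $u$; (4) $\bigcup\lambda_u\cap\bigcup_{w\in T_u}B_w\subseteq B_u$ for every $u$, where $T_u$ is the subtree of $T$ rooted at $u$. Its width is $\max_u|\lambda_u|$; $\mathrm{hw}(H)$ is the minimal width of a hypertree decomposition of $H$, and $\beta\text{-}\mathrm{hw}(H)=\max\{\mathrm{hw}(H')\mid H'\text{ a subhypergraph of }H\}$. The *primal graph* of $H$ is the graph on $V(H)$ in which two distinct vertices are adjacent if some edge of $H$ contains both; the *incidence graph* is the bipartite graph on the disjoint union of $V(H)$ and $E(H)$ in which $v$ and $e$ are adjacent if $v\in e$. Treewidth and clique width of graphs are the usual ones. For $n\ge 3$, the cycle $C_n$ is the cycle graph on $n$ vertices, regarded as a hypergraph with $n$ edges of size two. **Theorem.** 1. For every hypergraph $H$, $\beta\text{-}\mathrm{hw}(H)\le 3\,\mathrm{nsw}(H)+1$. 2. On the class $\{C_n\mid n\ge 3\}$, the $\beta$-hypertree width, the treewidth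 and clique width of the primal graph, and the treewidth and clique width of the incidence graph are all bounded, whereas the nest-set width is unbounded. In particular, bounded $\mathrm{nsw}$ is a strictly less general property than bounded $\beta\text{-}\mathrm{hw}$: every class of hypergraphs with bounded $\mathrm{nsw}$ has bounded $\beta\text{-}\mathrm{hw}$, and there is a class of hypergraphs with bounded $\beta\text{-}\mathrm{hw}$ and unbounded $\mathrm{nsw}$. -/

import Mathlib

noncomputable section

namespace Hypergraph

variable {α : Type*}

/-- `H'` is a subhypergraph of `H`: it is given by a subset of the edges of `H`, and its vertices
are exactly those covered by these edges. -/
def IsSubhypergraph (H' H : Hypergraph α) : Prop :=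
  H'.edgeSet ⊆ H.edgeSet ∧ H'.vertexSet = ⋃₀ H'.edgeSet

/-- The vertex-induced subhypergraph `H[U]`. -/
def induce (H : Hypergraph α) (U : Set α) : Hypergraph α where
  vertexSet := U
  edgeSet := ((fun e => e ∩ U) '' H.edgeSet) \ {∅}
  subset_vertexSet_of_mem_edgeSet' := by
    rintro _ ⟨⟨e, _, rfl⟩, _⟩
    exact Set.inter_subset_right

/-- The hypergraph `H - X`. -/
def deleteVerts (H : Hypergraph α) (X : Set α) : Hypergraph α :=
  H.induce (H.vertexSet \ X)

/-- The set of edges incident to (at least one vertex of) `s`. -/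
def incidentEdges (H : Hypergraph α) (s : Set α) : Set (Set α) :=
  {e ∈ H.edgeSet | ∃ v ∈ s, v ∈ e}

/-! ### Nest-set width -/

/-- A non-empty set `s` of vertices is a nest-set if the sets `e \ s`, for the edges `e` incident
to `s`, are linearly ordered by inclusion. -/
def IsNestSet (H : Hypergraph α) (s : Set α) : Prop :=
  s.Nonempty ∧ s ⊆ H.vertexSet ∧ IsChain (· ⊆ ·) ((fun e => e \ s) '' H.incidentEdges s)

/-- Nest-set elimination orderings: the members of the sequence are deleted one after the other,
each of them is a nest-set of the hypergraph that is left when its turn comes, and the empty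
hypergraph remains at the end. -/
def IsNEO : Hypergraph α → List (Set α) → Prop
  | H, [] => H = ⊥
  | H, s :: l => H.IsNestSet s ∧ IsNEO (H.deleteVerts s) l

/-- A `k`-NEO is a NEO all of whose members have at most `k` elements. -/
def IsKNEO (H : Hypergraph α) (k : ℕ) (l : List (Set α)) : Prop :=
  H.IsNEO l ∧ ∀ s ∈ l, s.encard ≤ k

/-- The nest-set width: the least natural number `k` for which there is a `k`-NEO
(`⊤` if there is none). -/
def nestSetWidth (H : Hypergraph α) : ℕ∞ :=
  ⨅ (k : ℕ) (_ : ∃ l, H.IsKNEO k l), (k : ℕ∞)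

/-! ### Hypertree width -/

/-- Hypertree decompositions of `H`; the decomposition tree is finite and rooted. -/
structure HypertreeDecomposition (H : Hypergraph α) where
  /-- the nodes of the decomposition tree -/
  node : Type
  finite_node : Finite node
  /-- the decomposition tree -/
  tree : SimpleGraph node
  isTree : tree.IsTree
  root : node
  bag : node → Set α
  bag_subset : ∀ u, bag u ⊆ H.vertexSet
  cover : node → Set (Set α)
  cover_subset : ∀ u, cover u ⊆ H.edgeSet
  /-- The nodes whose bag contains `v` form a subtree. It may be empty, which by the next
  condition is possible only for a vertex that lies in no edge. -/
  connected : ∀ v ∈ H.vertexSet, (tree.induce {u | v ∈ bag u}).Preconnected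
  exists_edge_subset_bag : ∀ e ∈ H.edgeSet, ∃ u, e ⊆ bag u
  bag_subset_cover : ∀ u, bag u ⊆ ⋃₀ cover u
  /-- The special condition. A node `w` belongs to the subtree rooted at `u` exactly if `u` lies
  on the path from the root to `w`. -/
  special : ∀ u, ⋃₀ cover u ∩
    (⋃ w ∈ {w : node | ∃ p : tree.Walk root w, p.IsPath ∧ u ∈ p.support}, bag w) ⊆ bag u

/-- The width of a hypertree decomposition: the maximal size of a cover. -/
def HypertreeDecomposition.width {H : Hypergraph α} (D : H.HypertreeDecomposition) : ℕ∞ :=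
  ⨆ u, (D.cover u).encard

/-- The hypertree width: the minimal width of a hypertree decomposition. -/
def hypertreeWidth (H : Hypergraph α) : ℕ∞ :=
  ⨅ D : H.HypertreeDecomposition, D.width

/-- The `β`-hypertree width: the maximal hypertree width of a subhypergraph. -/
def betaHypertreeWidth (H : Hypergraph α) : ℕ∞ :=
  ⨆ (H' : Hypergraph α) (_ : H'.IsSubhypergraph H), H'.hypertreeWidth

/-! ### Graphs of a hypergraph, and graphs as hypergraphs -/

/-- The primal graph: two distinct vertices are adjacent if they lie in a common edge. -/
def primalGraph (H : Hypergraph α) : SimpleGraph H.vertexSet where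
  Adj u v := u ≠ v ∧ H.Adj (u : α) (v : α)
  symm := ⟨fun _ _ h => ⟨h.1.symm, h.2.symm⟩⟩
  loopless := ⟨fun _ h => h.1 rfl⟩

/-- The incidence graph: the bipartite graph between the vertices and the edges of `H`, with a
vertex adjacent to the edges that contain it. -/
def incidenceGraph (H : Hypergraph α) : SimpleGraph (H.vertexSet ⊕ H.edgeSet) :=
  SimpleGraph.fromRel fun x y =>
    ∃ (v : H.vertexSet) (e : H.edgeSet), x = Sum.inl v ∧ y = Sum.inr e ∧ (v : α) ∈ (e : Set α)

/-- A graph, considered as a hypergraph all of whose edges have two elements. -/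
def ofSimpleGraph (G : SimpleGraph α) : Hypergraph α where
  vertexSet := Set.univ
  edgeSet := {e | ∃ u v, G.Adj u v ∧ e = {u, v}}
  subset_vertexSet_of_mem_edgeSet' := fun _ _ => Set.subset_univ _

end Hypergraph

namespace SimpleGraph

variable {V : Type*}

/-! ### Treewidth -/

/-- Tree decompositions of a graph. -/
structure TreeDecomposition (G : SimpleGraph V) where
  /-- the nodes of the decomposition tree -/
  node : Type
  finite_node : Finite node
  /-- the decomposition tree -/
  tree : SimpleGraph node
  isTree : tree.IsTree
  bag : node → Set V
  exists_mem_bag : ∀ v, ∃ t, v ∈ bag t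
  exists_adj_mem_bag : ∀ u v, G.Adj u v → ∃ t, u ∈ bag t ∧ v ∈ bag t
  connected : ∀ v, (tree.induce {t | v ∈ bag t}).Preconnected

/-- The treewidth: the minimum, over all tree decompositions, of the maximal size of a bag,
minus one. (For a graph without vertices the subtraction is truncated to `0`.) -/
def treewidth (G : SimpleGraph V) : ℕ∞ :=
  ⨅ D : G.TreeDecomposition, (⨆ t, (D.bag t).encard) - 1

/-! ### Clique width -/

/-- The expressions over the label set `Fin k` that build labelled graphs. (The empty graph is
included only in order to give the graph without vertices an expression.) -/
inductive CliqueExpr (k : ℕ) : Type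
  | empty : CliqueExpr k
  /-- a single vertex with label `i` -/
  | vertex (i : Fin k) : CliqueExpr k
  /-- disjoint union -/
  | union (s t : CliqueExpr k) : CliqueExpr k
  /-- add all edges between vertices labelled `i` and vertices labelled `j`, where `i ≠ j` -/
  | join (i j : Fin k) (hij : i ≠ j) (t : CliqueExpr k) : CliqueExpr k
  /-- change every label `i` into `j` -/
  | relabel (i j : Fin k) (t : CliqueExpr k) : CliqueExpr k

namespace CliqueExpr

variable {k : ℕ}

/-- The vertices of the graph built by an expression. -/
def Vert : CliqueExpr k → Type
  | empty => Empty
  | vertex _ => Unit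
  | union s t => s.Vert ⊕ t.Vert
  | join _ _ _ t => t.Vert
  | relabel _ _ t => t.Vert

/-- The labels of the vertices of the graph built by an expression. -/
def label : (t : CliqueExpr k) → t.Vert → Fin k
  | empty => Empty.elim
  | vertex i => fun _ => i
  | union s t => Sum.elim s.label t.label
  | join _ _ _ t => t.label
  | relabel i j t => fun v => if t.label v = i then j else t.label v

/-- The graph built by an expression. -/
def graph : (t : CliqueExpr k) → SimpleGraph t.Vert
  | empty => (⊥ : SimpleGraph Empty)
  | vertex _ => (⊥ : SimpleGraph Unit)
  | union s t => SimpleGraph.sum s.graph t.graph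
  | join i j _ t => t.graph ⊔ SimpleGraph.fromRel fun u v => t.label u = i ∧ t.label v = j
  | relabel _ _ t => t.graph

end CliqueExpr

/-- The clique width: the least number `k` of labels such that the graph is built (up to
isomorphism) by an expression over `k` labels. -/
def cliqueWidth (G : SimpleGraph V) : ℕ∞ :=
  ⨅ (k : ℕ) (_ : ∃ t : CliqueExpr k, Nonempty (G ≃g t.graph)), (k : ℕ∞)

end SimpleGraph

/-- A finite hypergraph, together with its ambient type of vertices. Classes of hypergraphs are
sets of these. -/
structure FiniteHypergraph where
  carrier : Type
  graph : Hypergraph carrier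
  finite_vertexSet : graph.vertexSet.Finite

namespace FiniteHypergraph

/-- A width measure `w` is bounded on the class `C` of hypergraphs. -/
def Bounded (w : FiniteHypergraph → ℕ∞) (C : Set FiniteHypergraph) : Prop :=
  ∃ c : ℕ, ∀ H ∈ C, w H ≤ c

/-- The nest-set width of a finite hypergraph. -/
def nsw (H : FiniteHypergraph) : ℕ∞ := H.graph.nestSetWidth

/-- The `β`-hypertree width of a finite hypergraph. -/
def betaHw (H : FiniteHypergraph) : ℕ∞ := H.graph.betaHypertreeWidth

/-- The cycle with `n` vertices, as a hypergraph. -/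
def cycle (n : ℕ) : FiniteHypergraph where
  carrier := Fin n
  graph := Hypergraph.ofSimpleGraph (SimpleGraph.cycleGraph n)
  finite_vertexSet := Set.toFinite _

/-- The class of all cycles. -/
def cycles : Set FiniteHypergraph := {H | ∃ n, 3 ≤ n ∧ H = cycle n}

end FiniteHypergraph

end

/-!
The bound on the `β`-hypertree width goes through balanced separators. Along a nest-set elimination
the neighbours of a nest-set among the remaining vertices all lie in one edge, so the nest-set and
these neighbours are covered by `k` edges (`EdgeSet.exists_cover_of_isChain`), and every component
of the vertices removed so far has its remaining neighbours in a single edge. For a set `M` of edges,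
consider the first nest-set whose removal creates a component that meets more than half of `M`. The
edges covering it separate the hypergraph into components that meet at most half of `M` each
(`EdgeSet.Eliminable.hasSeparators`).

Balanced separators of `k` edges yield hypertree decompositions of width `3 * k + 1`, as in the
proof of Adler, Gottlob and Grohe that hypertree width is at most three times the generalized
hypertree width plus one
(`EdgeSet.HasSeparators.nonempty_partialDecomposition`). The decomposition of a vertex set `C` whose
neighbours are covered by a set `M` of `2 * k` edges has at its root the cover consisting of `M`, one
edge that meets `C`, and a balanced separator `S` of these `2 * k + 1` edges; its bag consists of the
covered vertices among `C` and the neighbours of `C`, which makes the special condition automatic.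
The neighbours of a remaining component of `C` are covered by `S` and by the at most `k` other edges
that meet its component outside `S`, so that the recursion continues.

Since eliminability is inherited by subsets of the edges, the bound holds for all subhypergraphs.
Cycles are treated by the same construction: one edge covers a vertex, and the remaining path is
eliminated by single vertices. A nest-set of a cycle misses at most one vertex
(`FiniteHypergraph.le_encard_of_isNestSet_cycle`), so the nest-set width of cycles is unbounded. The
primal and the incidence graph of a cycle are cycles again; an enumeration of their vertices along
the cycle gives a tree decomposition along a path and a clique-width expression that adds one
vertex at a time (`SimpleGraph.IsCyclicLayout`).
-/

/-! ### Rooted trees -/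

/-- A rooted tree on `ι`, given by a parent map. The depth function is any function that decreases
from a node to its parent; the parent of the root is irrelevant. -/
structure ParentTree (ι : Type*) where
  root : ι
  parent : ι → ι
  depth : ι → ℕ
  depth_parent_lt : ∀ u, u ≠ root → depth (parent u) < depth u

namespace ParentTree

variable {ι : Type*} (T : ParentTree ι)

/-- The underlying graph of a rooted tree. -/
def graph : SimpleGraph ι :=
  SimpleGraph.fromRel fun u w => u ≠ T.root ∧ T.parent u = w

variable {T}

theorem adj_parent {u : ι} (hu : u ≠ T.root) : T.graph.Adj u (T.parent u) := by
  refine (SimpleGraph.fromRel_adj _ _ _).2 ⟨fun h => ?_, Or.inl ⟨hu, rfl⟩⟩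
  have := T.depth_parent_lt u hu
  rw [← h] at this
  exact lt_irrefl _ this

/-- The path from the root to `w` runs through ancestors of `w` only, so a family of sets that grows
from each node to its parent is at least `f w` along it. -/
theorem exists_isPath_root {α : Type*} {f : ι → Set α}
    (hf : ∀ u, u ≠ T.root → f u ⊆ f (T.parent u)) (w : ι) :
    ∃ p : T.graph.Walk T.root w, p.IsPath ∧
      (∀ u ∈ p.support, T.depth u ≤ T.depth w) ∧
      ∀ u ∈ p.support, f w ⊆ f u := by
  induction hn : T.depth w using Nat.strong_induction_on generalizing w with
  | _ n ih =>
    by_cases hw : w = T.root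
    · subst hw
      exact ⟨.nil, by simp, by simp [hn], by simp⟩
    · have hlt := T.depth_parent_lt w hw
      obtain ⟨p, hp, hd, hp'⟩ := ih _ (hn ▸ hlt) (T.parent w) rfl
      refine ⟨p.concat (adj_parent hw).symm, ?_, ?_, ?_⟩
      · refine hp.concat (fun h => ?_) _
        have := hd _ h
        omega
      · intro u hu
        rw [SimpleGraph.Walk.support_concat, List.mem_append, List.mem_singleton] at hu
        rcases hu with hu | rfl
        · have := hd _ hu
          omega
        · exact hn.le
      · intro u hu
        rw [SimpleGraph.Walk.support_concat, List.mem_append, List.mem_singleton] at hu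
        rcases hu with hu | rfl
        · exact (hf w hw).trans (hp' u hu)
        · exact subset_rfl

theorem isTree [Finite ι] : T.graph.IsTree := by
  have hconn : T.graph.Connected := by
    have : Nonempty ι := ⟨T.root⟩
    refine ⟨fun u w => ?_⟩
    obtain ⟨p, -⟩ := exists_isPath_root (T := T) (f := fun _ => (∅ : Set ι)) (by simp) u
    obtain ⟨q, -⟩ := exists_isPath_root (T := T) (f := fun _ => (∅ : Set ι)) (by simp) w
    exact p.reachable.symm.trans q.reachable
  refine SimpleGraph.isTree_iff_connected_and_card.2 ⟨hconn, le_antisymm ?_ ?_⟩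
  · -- every edge joins a node other than the root to its parent
    let g : {u // u ≠ T.root} → T.graph.edgeSet := fun u => ⟨s(u, T.parent u), adj_parent u.2⟩
    have hg : Function.Surjective g := by
      rintro ⟨e, he⟩
      induction e using Sym2.ind with
      | _ a b =>
        rw [SimpleGraph.mem_edgeSet] at he
        rcases ((SimpleGraph.fromRel_adj _ _ _).1 he).2 with ⟨h, rfl⟩ | ⟨h, rfl⟩
        · exact ⟨⟨a, h⟩, rfl⟩
        · exact ⟨⟨b, h⟩, Subtype.ext Sym2.eq_swap⟩
    have h1 := Nat.card_le_card_of_surjective g hg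
    have h2 : Nat.card {u // u ≠ T.root} + 1 ≤ Nat.card ι := by
      have := Set.ncard_lt_card (s := {u | u ≠ T.root}) (fun h => (h ▸ Set.mem_univ T.root :
        T.root ∈ {u | u ≠ T.root}) rfl)
      exact this
    omega
  · exact hconn.card_vert_le_card_edgeSet_add_one

theorem subset_of_mem_support_of_isPath [Finite ι] {α : Type*} {f : ι → Set α}
    (hf : ∀ u, u ≠ T.root → f u ⊆ f (T.parent u)) {w : ι} {p : T.graph.Walk T.root w}
    (hp : p.IsPath) {u : ι} (hu : u ∈ p.support) : f w ⊆ f u := by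
  obtain ⟨q, hq, -, h⟩ := exists_isPath_root hf w
  obtain rfl : p = q := (T.isTree.existsUnique_path _ _).unique hp hq
  exact h u hu

/-- A set of nodes is connected if it has a top node `t`, that is, if it is closed under passing
from a node other than `t` to the parent. -/
theorem induce_preconnected {s : Set ι} (t : ι)
    (h : ∀ u ∈ s, u = t ∨ u ≠ T.root ∧ T.parent u ∈ s) : (T.graph.induce s).Preconnected := by
  have key : ∀ u (hu : u ∈ s), ∃ ht : t ∈ s, (T.graph.induce s).Reachable ⟨u, hu⟩ ⟨t, ht⟩ := by
    intro u
    induction hn : T.depth u using Nat.strong_induction_on generalizing u with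
    | _ n ih =>
      intro hu
      rcases h u hu with rfl | ⟨hr, hp⟩
      · exact ⟨hu, .rfl⟩
      · obtain ⟨ht, hreach⟩ := ih _ (hn ▸ T.depth_parent_lt u hr) _ rfl hp
        refine ⟨ht, .trans (SimpleGraph.Adj.reachable ?_) hreach⟩
        exact adj_parent hr
  rintro ⟨u, hu⟩ ⟨w, hw⟩
  obtain ⟨ht, h1⟩ := key u hu
  obtain ⟨_, h2⟩ := key w hw
  exact h1.trans h2.symm

end ParentTree

/-! ### Balanced separators from eliminations -/

namespace EdgeSet

variable {α : Type*} {E : Set (Set α)} {k : ℕ}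

/-- Two vertices touch if they lie in a common edge of `E`. -/
def Touch (E : Set (Set α)) (a b : α) : Prop := ∃ e ∈ E, a ∈ e ∧ b ∈ e

theorem Touch.symm {a b : α} (h : Touch E a b) : Touch E b a := by
  obtain ⟨e, he, ha, hb⟩ := h
  exact ⟨e, he, hb, ha⟩

/-- The connected component of `v` in the subhypergraph induced on the vertex set `W`. It is
meaningful only for `v ∈ W`. -/
def comp (E : Set (Set α)) (W : Set α) (v : α) : Set α :=
  {u | Relation.ReflTransGen (fun a b => b ∈ W ∧ Touch E a b) v u}

theorem mem_comp_self {W : Set α} {v : α} : v ∈ comp E W v := Relation.ReflTransGen.refl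

theorem mem_comp_of_touch {W : Set α} {v a b : α} (ha : a ∈ comp E W v) (hb : b ∈ W)
    (h : Touch E a b) : b ∈ comp E W v := Relation.ReflTransGen.tail ha ⟨hb, h⟩

theorem comp_subset_of_closed {W P : Set α} {v : α} (hv : v ∈ P)
    (h : ∀ a ∈ P, ∀ b ∈ W, Touch E a b → b ∈ P) : comp E W v ⊆ P := by
  intro u hu
  induction hu with
  | refl => exact hv
  | tail _ hbc ih => exact h _ ih _ hbc.1 hbc.2

theorem comp_subset {W : Set α} {v : α} (hv : v ∈ W) : comp E W v ⊆ W :=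
  comp_subset_of_closed hv fun _ _ _ hb _ => hb

theorem comp_subset_comp_of_mem {W : Set α} {v u : α} (hu : u ∈ comp E W v) :
    comp E W u ⊆ comp E W v :=
  comp_subset_of_closed hu fun _ ha _ hb h => mem_comp_of_touch ha hb h

theorem comp_mono {W W' : Set α} (h : W ⊆ W') (v : α) : comp E W v ⊆ comp E W' v :=
  comp_subset_of_closed mem_comp_self fun _ ha _ hb ht => mem_comp_of_touch ha (h hb) ht

theorem mem_comp_symm {W : Set α} {v u : α} (hv : v ∈ W) (hu : u ∈ comp E W v) :
    v ∈ comp E W u := by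
  have h : comp E W v ⊆ {u | u ∈ W ∧ v ∈ comp E W u} :=
    comp_subset_of_closed ⟨hv, mem_comp_self⟩ fun a ha b hb ht =>
      ⟨hb, comp_subset_comp_of_mem (mem_comp_of_touch mem_comp_self ha.1 ht.symm) ha.2⟩
  exact (h hu).2

theorem comp_eq_of_mem {W : Set α} {v u : α} (hv : v ∈ W) (hu : u ∈ comp E W v) :
    comp E W u = comp E W v :=
  (comp_subset_comp_of_mem hu).antisymm (comp_subset_comp_of_mem (mem_comp_symm hv hu))

/-- The vertex set `X` can be eliminated by removing successively sets of at most `k` vertices,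
each of which is a nest-set for the traces of the edges on the vertices that are left. In contrast
to a nest-set elimination ordering, the removed sets may be empty or overlap the vertices removed
before; this makes the notion hereditary in `E` and `X`. -/
inductive Eliminable (E : Set (Set α)) (k : ℕ) : Set α → Prop
  | empty : Eliminable E k ∅
  | step {X : Set α} (s : Set α) : s.encard ≤ k →
      IsChain (· ⊆ ·) ((fun e => e ∩ (X \ s)) '' {e ∈ E | (e ∩ (X ∩ s)).Nonempty}) →
      Eliminable E k (X \ s) → Eliminable E k X

theorem Eliminable.mono {E' : Set (Set α)} {X X' : Set α} (h : Eliminable E k X) (hE : E' ⊆ E)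
    (hX : X' ⊆ X) : Eliminable E' k X' := by
  induction h generalizing X' with
  | empty =>
    rw [Set.subset_empty_iff.1 hX]
    exact .empty
  | step s hs hc _ ih =>
    refine .step s hs ?_ (ih (Set.sdiff_subset_sdiff_left hX))
    rintro _ ⟨e, ⟨he, x, hx, hx'⟩, rfl⟩ _ ⟨f, ⟨hf, y, hy, hy'⟩, rfl⟩ -
    have := hc.total ⟨e, ⟨hE he, x, hx, hX hx'.1, hx'.2⟩, rfl⟩
      ⟨f, ⟨hE hf, y, hy, hX hy'.1, hy'.2⟩, rfl⟩
    exact this.imp (fun h z hz => ⟨(h ⟨hz.1, hX hz.2.1, hz.2.2⟩).1, hz.2⟩)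
      (fun h z hz => ⟨(h ⟨hz.1, hX hz.2.1, hz.2.2⟩).1, hz.2⟩)

/-- A nest-set with at most `k` elements, together with its neighbours, is covered by `k` edges;
all its neighbours lie in a single one of them. -/
theorem exists_cover_of_isChain (hE : E.Finite) {X s : Set α} (hX : X ⊆ ⋃₀ E)
    (hs : s.encard ≤ k) (hne : (X ∩ s).Nonempty)
    (hc : IsChain (· ⊆ ·) ((fun e => e ∩ (X \ s)) '' {e ∈ E | (e ∩ (X ∩ s)).Nonempty})) :
    ∃ S ⊆ E, S.encard ≤ k ∧ X ∩ s ⊆ ⋃₀ S ∧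
      ∃ e₀ ∈ S, ∀ e ∈ E, (e ∩ (X ∩ s)).Nonempty → e ∩ (X \ s) ⊆ e₀ := by
  classical
  set I := {e ∈ E | (e ∩ (X ∩ s)).Nonempty} with hI
  have hIne : I.Nonempty := by
    obtain ⟨x, hx⟩ := hne
    obtain ⟨e, he, hxe⟩ := hX hx.1
    exact ⟨e, he, x, hxe, hx⟩
  obtain ⟨m, hm⟩ := ((hE.subset (Set.sep_subset _ _)).image (fun e => e ∩ (X \ s))).exists_maximal
    (hIne.image _)
  obtain ⟨e₀, ⟨he₀, p, hp, hp'⟩, rfl⟩ := hm.1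
  choose g hg hxg using fun x : X => hX x.2
  -- every vertex of the nest-set in `e₀` is assigned the edge `e₀`
  let c : α → Set α := fun x => if x ∈ e₀ then e₀ else if hx : x ∈ X then g ⟨x, hx⟩ else ∅
  refine ⟨c '' (X ∩ s), ?_, ?_, ?_, e₀, ⟨p, hp', if_pos hp⟩, ?_⟩
  · rintro _ ⟨x, hx, rfl⟩
    by_cases h : x ∈ e₀
    · simpa [c, h] using he₀
    · simpa [c, h, hx.1] using hg _
  · exact (Set.encard_image_le _ _).trans ((Set.encard_le_encard Set.inter_subset_right).trans hs)
  · intro x hx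
    refine ⟨c x, ⟨x, hx, rfl⟩, ?_⟩
    by_cases h : x ∈ e₀
    · simp [c, h]
    · simpa [c, h, hx.1] using hxg ⟨x, hx.1⟩
  · intro e he hee
    rcases hc.total hm.1 ⟨e, ⟨he, hee⟩, rfl⟩ with h | h
    · exact (hm.2 ⟨e, ⟨he, hee⟩, rfl⟩ h).trans Set.inter_subset_left
    · exact h.trans Set.inter_subset_left

/-- At most half of the members of `M` meet `D`. -/
def AtMostHalf (M : Set (Set α)) (D : Set α) : Prop :=
  2 * {m ∈ M | (m ∩ D).Nonempty}.ncard ≤ M.ncard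

theorem AtMostHalf.mono {M : Set (Set α)} {D D' : Set α} (hM : M.Finite) (h : AtMostHalf M D)
    (hD : D' ⊆ D) : AtMostHalf M D' := by
  refine (Nat.mul_le_mul_left 2 (Set.ncard_le_ncard ?_ (hM.subset (Set.sep_subset _ _)))).trans h
  exact fun m hm => ⟨hm.1, hm.2.mono (Set.inter_subset_inter_right _ hD)⟩

/-- The elimination is followed until, after the removal of a nest-set `s`, some component `D` of
the removed vertices `X₀ \ X` meets more than half of `M`; then the edges covering `s` and its
neighbours are a separator. All neighbours of `D` that are left lie in one of these edges, so a
component outside the separator is either disjoint from `D`, and meets only edges of `M` that `D`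
does not meet, or it lies in a component of the vertices removed before `s`. The invariant `hN` says
that the neighbours among `X` of each component of the removed vertices lie in one edge: if the next
nest-set contains one of them, it therefore has all others among its own neighbours. -/
theorem exists_separator_aux (hE : E.Finite) {M : Set (Set α)} (hM : M ⊆ E) {X₀ X : Set α}
    (hX₀ : X₀ ⊆ ⋃₀ E) (h : Eliminable E k X) (hX : X ⊆ X₀)
    (hN : ∀ v ∈ X₀ \ X, ∃ e ∈ E, ∀ d ∈ comp E (X₀ \ X) v, ∀ x ∈ X, Touch E d x → x ∈ e)
    (hB : ∀ v ∈ X₀ \ X, AtMostHalf M (comp E (X₀ \ X) v)) :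
    ∃ S ⊆ E, S.encard ≤ k ∧ ∀ v ∈ X₀ \ ⋃₀ S, AtMostHalf M (comp E (X₀ \ ⋃₀ S) v) := by
  have hMf : M.Finite := hE.subset hM
  induction h with
  | empty => exact ⟨∅, Set.empty_subset _, by simp, by simpa using hB⟩
  | @step X s hs hc _ ih =>
    rcases (X ∩ s).eq_empty_or_nonempty with hemp | hne
    · have : X \ s = X := sdiff_eq_left.2 (Set.disjoint_iff_inter_eq_empty.2 hemp)
      rw [this] at ih
      exact ih hX hN hB
    obtain ⟨S, hSE, hSk, hsS, e₀, he₀S, he₀⟩ := exists_cover_of_isChain hE (hX.trans hX₀) hs hne hc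
    have hW : ∀ x, x ∈ X₀ \ (X \ s) → x ∉ X ∩ s → x ∈ X₀ \ X := fun x hx hx' =>
      ⟨hx.1, fun h => hx' ⟨h, by_contra fun h' => hx.2 ⟨h, h'⟩⟩⟩
    have hWW : X₀ \ X ⊆ X₀ \ (X \ s) := Set.sdiff_subset_sdiff_right Set.sdiff_subset
    -- a component that avoids the nest-set is an old one
    have hold : ∀ v ∈ X₀ \ (X \ s), comp E (X₀ \ (X \ s)) v ∩ (X ∩ s) = ∅ →
        v ∈ X₀ \ X ∧ comp E (X₀ \ (X \ s)) v ⊆ comp E (X₀ \ X) v := by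
      intro v hv hd
      have hd' : ∀ x ∈ comp E (X₀ \ (X \ s)) v, x ∉ X ∩ s := fun x hx hx' =>
        (Set.eq_empty_iff_forall_notMem.1 hd x) ⟨hx, hx'⟩
      refine ⟨hW v hv (hd' v mem_comp_self), fun x hx => ?_⟩
      have : comp E (X₀ \ (X \ s)) v ⊆ comp E (X₀ \ (X \ s)) v ∩ comp E (X₀ \ X) v := by
        refine comp_subset_of_closed ⟨mem_comp_self, mem_comp_self⟩ fun a ha b hb hab => ?_
        have hb' := mem_comp_of_touch ha.1 hb hab
        exact ⟨hb', mem_comp_of_touch ha.2 (hW b hb (hd' b hb')) hab⟩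
      exact (this hx).2
    -- the remaining neighbours of a component that meets the nest-set are neighbours of the latter
    have hnew : ∀ v ∈ X₀ \ (X \ s), (comp E (X₀ \ (X \ s)) v ∩ (X ∩ s)).Nonempty →
        ∀ d ∈ comp E (X₀ \ (X \ s)) v, ∀ x ∈ X \ s, Touch E d x → x ∈ e₀ := by
      rintro v hv ⟨t, htv, hts⟩ d hd x hx hdx
      by_cases hds : d ∈ X ∩ s
      · obtain ⟨e, he, hde, hxe⟩ := hdx
        exact he₀ e he ⟨d, hde, hds⟩ ⟨hxe, hx⟩
      · have hdW := hW d (comp_subset hv hd) hds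
        have htd : t ∈ comp E (X₀ \ (X \ s)) d := by rwa [comp_eq_of_mem hv hd]
        obtain ⟨a, ha, b, hb, hab⟩ :
            ∃ a ∈ comp E (X₀ \ X) d, ∃ b ∈ X ∩ s, Touch E a b := by
          by_contra! hno
          have : comp E (X₀ \ (X \ s)) d ⊆ comp E (X₀ \ X) d :=
            comp_subset_of_closed mem_comp_self fun a ha b hb hab =>
              mem_comp_of_touch ha (hW b hb fun hbs => hno a ha b hbs hab) hab
          exact (comp_subset hdW (this htd)).2 hts.1
        obtain ⟨e, he, hNe⟩ := hN d hdW
        exact he₀ e he ⟨b, hNe a ha b hb.1 hab, hb⟩ ⟨hNe d mem_comp_self x hx.1 hdx, hx⟩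
    by_cases hB' : ∀ v ∈ X₀ \ (X \ s), AtMostHalf M (comp E (X₀ \ (X \ s)) v)
    · refine ih (Set.sdiff_subset.trans hX) (fun v hv => ?_) hB'
      rcases (comp E (X₀ \ (X \ s)) v ∩ (X ∩ s)).eq_empty_or_nonempty with hd | hd
      · obtain ⟨hvW, hsub⟩ := hold v hv hd
        obtain ⟨e, he, hNe⟩ := hN v hvW
        exact ⟨e, he, fun d hd' x hx => hNe d (hsub hd') x hx.1⟩
      · exact ⟨e₀, hSE he₀S, hnew v hv hd⟩
    · push Not at hB'
      obtain ⟨v, hv, hvB⟩ := hB'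
      have hd : (comp E (X₀ \ (X \ s)) v ∩ (X ∩ s)).Nonempty := by
        by_contra hd
        obtain ⟨hvW, hsub⟩ := hold v hv (Set.not_nonempty_iff_eq_empty.1 hd)
        exact hvB ((hB v hvW).mono hMf hsub)
      have hN' := hnew v hv hd
      have hleave : ∀ x ∈ X₀ \ ⋃₀ S, x ∉ X ∩ s := fun x hx hx' => hx.2 (hsS hx')
      have hstay : ∀ d ∈ comp E (X₀ \ (X \ s)) v, ∀ x ∈ X₀ \ ⋃₀ S, Touch E d x →
          x ∈ X₀ \ (X \ s) := fun d hd x hx hdx =>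
        ⟨hx.1, fun hx' => hx.2 ⟨e₀, he₀S, hN' d hd x hx' hdx⟩⟩
      refine ⟨S, hSE, hSk, fun w hw => ?_⟩
      rcases (comp E (X₀ \ ⋃₀ S) w ∩ comp E (X₀ \ (X \ s)) v).eq_empty_or_nonempty with
        hemp | ⟨z, hzw, hzv⟩
      · -- an edge that meets both components would give a neighbour of the large one outside `e₀`
        have hdisj : Disjoint {m ∈ M | (m ∩ comp E (X₀ \ ⋃₀ S) w).Nonempty}
            {m ∈ M | (m ∩ comp E (X₀ \ (X \ s)) v).Nonempty} := by
          rw [Set.disjoint_left]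
          rintro m ⟨hmM, c, hcm, hc⟩ ⟨-, d, hdm, hd⟩
          have hcd : Touch E d c := ⟨m, hM hmM, hdm, hcm⟩
          have hc' := hstay d hd c (comp_subset hw hc) hcd
          exact Set.eq_empty_iff_forall_notMem.1 hemp c ⟨hc, mem_comp_of_touch hd hc' hcd⟩
        have h1 := Set.ncard_union_eq hdisj (hMf.subset (Set.sep_subset _ _))
          (hMf.subset (Set.sep_subset _ _))
        have h2 := Set.ncard_le_ncard (Set.union_subset (Set.sep_subset M
          fun m => (m ∩ comp E (X₀ \ ⋃₀ S) w).Nonempty) (Set.sep_subset M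
          fun m => (m ∩ comp E (X₀ \ (X \ s)) v).Nonempty)) hMf
        unfold AtMostHalf at hvB ⊢
        omega
      · have hzW : z ∈ X₀ \ X := hW z (comp_subset hv hzv) (hleave z (comp_subset hw hzw))
        have : comp E (X₀ \ ⋃₀ S) z ⊆ comp E (X₀ \ X) z ∩ comp E (X₀ \ (X \ s)) v := by
          refine comp_subset_of_closed ⟨mem_comp_self, hzv⟩ fun a ha b hb hab => ?_
          have hb' := hstay a ha.2 b hb hab
          exact ⟨mem_comp_of_touch ha.1 (hW b hb' (hleave b hb)) hab,
            mem_comp_of_touch ha.2 hb' hab⟩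
        rw [← comp_eq_of_mem hw hzw]
        exact (hB z hzW).mono hMf (this.trans Set.inter_subset_left)

/-- Every set `M` of edges has a balanced separator that is covered by `k` edges. -/
def HasSeparators (E : Set (Set α)) (k : ℕ) : Prop :=
  ∀ M ⊆ E, ∃ S ⊆ E, S.encard ≤ k ∧
    ∀ v ∈ ⋃₀ E \ ⋃₀ S, AtMostHalf M (comp E (⋃₀ E \ ⋃₀ S) v)

/-- If the vertices outside `j` edges can be eliminated by nest-sets of size `k`, then these
`j` edges, together with the `k` edges covering a suitable nest-set and its neighbours, form a
balanced separator. -/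
theorem Eliminable.hasSeparators (hE : E.Finite) {J : Set (Set α)} {j : ℕ} (hJ : J ⊆ E)
    (hj : J.encard ≤ j) (h : Eliminable E k (⋃₀ E \ ⋃₀ J)) : HasSeparators E (k + j) := by
  intro M hM
  obtain ⟨S, hSE, hSk, hS⟩ := exists_separator_aux hE hM Set.sdiff_subset h subset_rfl
    (by simp) (by simp)
  refine ⟨S ∪ J, Set.union_subset hSE hJ, ?_, ?_⟩
  · exact (Set.encard_union_le _ _).trans (by push_cast; exact add_le_add hSk hj)
  · have : ⋃₀ E \ ⋃₀ (S ∪ J) = (⋃₀ E \ ⋃₀ J) \ ⋃₀ S := by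
      rw [Set.sUnion_union, Set.sdiff_sdiff, Set.union_comm]
    rwa [this]

end EdgeSet

/-! ### Hypertree decompositions from balanced separators -/

namespace EdgeSet

variable {α : Type*} {E : Set (Set α)} {k : ℕ}

/-- The vertices outside `C` that have a neighbour in `C`. -/
def nbr (E : Set (Set α)) (C : Set α) : Set α := {x | x ∉ C ∧ ∃ c ∈ C, Touch E c x}

theorem subset_union_nbr {C e : Set α} (he : e ∈ E) (h : (e ∩ C).Nonempty) :
    e ⊆ C ∪ nbr E C := by
  obtain ⟨c, hce, hc⟩ := h
  intro x hx
  by_cases hxC : x ∈ C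
  · exact Or.inl hxC
  · exact Or.inr ⟨hxC, c, hc, e, he, hce, hx⟩

/-- A hypertree decomposition of width at most `w` of the edges that meet the vertex set `C`, with
the neighbours of `C` in the root bag. The set `region u` bounds the bags in the subtree
rooted at `u`. -/
structure PartialDecomposition (E : Set (Set α)) (w : ℕ) (C : Set α) where
  node : Type
  finite_node : Finite node
  tree : ParentTree node
  bag : node → Set α
  cover : node → Set (Set α)
  region : node → Set α
  cover_subset : ∀ u, cover u ⊆ E
  encard_cover_le : ∀ u, (cover u).encard ≤ w
  bag_subset_cover : ∀ u, bag u ⊆ ⋃₀ cover u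
  bag_subset_region : ∀ u, bag u ⊆ region u
  region_subset_parent : ∀ u, u ≠ tree.root → region u ⊆ region (tree.parent u)
  cover_inter_region : ∀ u, ⋃₀ cover u ∩ region u ⊆ bag u
  region_root : region tree.root ⊆ C ∪ nbr E C
  nbr_subset : nbr E C ⊆ bag tree.root
  exists_edge_subset_bag : ∀ e ∈ E, (e ∩ C).Nonempty → ∃ u, e ⊆ bag u
  /-- The nodes whose bag contains `v` have a top node, so they form a subtree. -/
  exists_top : ∀ v, ∃ t, ∀ u, v ∈ bag u → u = t ∨ u ≠ tree.root ∧ v ∈ bag (tree.parent u)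

/-- The regions shrink away from the root, so all of them lie in the region of the root. -/
theorem PartialDecomposition.region_subset {w : ℕ} {C : Set α} (P : PartialDecomposition E w C)
    (u : P.node) : P.region u ⊆ C ∪ nbr E C := by
  have := P.finite_node
  obtain ⟨p, hp⟩ := P.tree.isTree.existsUnique_path P.tree.root u
  exact (P.tree.subset_of_mem_support_of_isPath P.region_subset_parent hp.1
    p.start_mem_support).trans P.region_root

open scoped Classical in
/-- Decompositions of the parts `D i` of `C` that remain after the removal of the vertices
covered by `L` are joined by a new root with cover `L`. -/
noncomputable def PartialDecomposition.glue {w : ℕ} {C : Set α} (L : Set (Set α)) (hLE : L ⊆ E)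
    (hLw : L.encard ≤ w) (hL : nbr E C ⊆ ⋃₀ L) {n : ℕ} (D : Fin n → Set α)
    (hD : ∀ i, D i ⊆ C \ ⋃₀ L)
    (hclosed : ∀ i, ∀ a ∈ D i, ∀ b ∈ C \ ⋃₀ L, Touch E a b → b ∈ D i)
    (hcov : C \ ⋃₀ L ⊆ ⋃ i, D i) (hdisj : ∀ i j v, v ∈ D i → v ∈ D j → i = j)
    (P : ∀ i, PartialDecomposition E w (D i)) : PartialDecomposition E w C :=
  have hnbr : ∀ i, nbr E (D i) ⊆ ⋃₀ L ∩ (C ∪ nbr E C) := by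
    rintro i x ⟨hx, d, hd, hdx⟩
    have hdC := (hD i hd).1
    by_cases hxC : x ∈ C
    · exact ⟨by_contra fun hxL => hx (hclosed i d hd x ⟨hxC, hxL⟩ hdx), Or.inl hxC⟩
    · have : x ∈ nbr E C := ⟨hxC, d, hdC, hdx⟩
      exact ⟨hL this, Or.inr this⟩
  have hreg : ∀ i u, (P i).region u ⊆ C ∪ nbr E C := fun i u =>
    ((P i).region_subset u).trans (Set.union_subset
      (((hD i).trans Set.sdiff_subset).trans Set.subset_union_left)
      ((hnbr i).trans Set.inter_subset_right))
  { node := Option (Σ i, (P i).node)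
    finite_node := by
      have := fun i => (P i).finite_node
      infer_instance
    tree :=
      { root := none
        parent := fun u => u.elim none fun q =>
          if q.2 = (P q.1).tree.root then none else some ⟨q.1, (P q.1).tree.parent q.2⟩
        depth := fun u => u.elim 0 fun q => (P q.1).tree.depth q.2 + 1
        depth_parent_lt := by
          rintro (_ | ⟨i, u⟩) hu
          · exact absurd rfl hu
          · by_cases h : u = (P i).tree.root
            · simp [h]
            · simpa [h] using (P i).tree.depth_parent_lt u h }
    bag := fun u => u.elim (⋃₀ L ∩ (C ∪ nbr E C)) fun q => (P q.1).bag q.2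
    cover := fun u => u.elim L fun q => (P q.1).cover q.2
    region := fun u => u.elim (C ∪ nbr E C) fun q => (P q.1).region q.2
    cover_subset := by
      rintro (_ | ⟨i, u⟩)
      exacts [hLE, (P i).cover_subset u]
    encard_cover_le := by
      rintro (_ | ⟨i, u⟩)
      exacts [hLw, (P i).encard_cover_le u]
    bag_subset_cover := by
      rintro (_ | ⟨i, u⟩)
      exacts [Set.inter_subset_left, (P i).bag_subset_cover u]
    bag_subset_region := by
      rintro (_ | ⟨i, u⟩)
      exacts [Set.inter_subset_right, (P i).bag_subset_region u]
    region_subset_parent := by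
      rintro (_ | ⟨i, u⟩) hu
      · exact absurd rfl hu
      · by_cases h : u = (P i).tree.root
        · simpa [h] using hreg i _
        · simpa [h] using (P i).region_subset_parent u h
    cover_inter_region := by
      rintro (_ | ⟨i, u⟩)
      exacts [subset_rfl, (P i).cover_inter_region u]
    region_root := subset_rfl
    nbr_subset := fun x hx => ⟨hL hx, Or.inr hx⟩
    exists_edge_subset_bag := by
      intro e he heC
      by_cases h : ∃ i, (e ∩ D i).Nonempty
      · obtain ⟨i, hi⟩ := h
        obtain ⟨u, hu⟩ := (P i).exists_edge_subset_bag e he hi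
        exact ⟨some ⟨i, u⟩, hu⟩
      · have hsub := subset_union_nbr he heC
        refine ⟨none, fun x hx => ⟨?_, hsub hx⟩⟩
        by_contra hxL
        rcases hsub hx with hxC | hxN
        · obtain ⟨i, hi⟩ := Set.mem_iUnion.1 (hcov ⟨hxC, hxL⟩)
          exact h ⟨i, x, hx, hi⟩
        · exact hxL (hL hxN)
    exists_top := by
      intro v
      by_cases hv : v ∈ ⋃₀ L ∩ (C ∪ nbr E C)
      · refine ⟨none, ?_⟩
        rintro (_ | ⟨i, u⟩) hu
        · exact Or.inl rfl
        refine Or.inr ⟨by simp, ?_⟩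
        by_cases h : u = (P i).tree.root
        · simpa [h] using hv
        -- `v` is a neighbour of `D i`, hence in the root bag of its decomposition
        have hvr : v ∈ (P i).bag (P i).tree.root := by
          refine (P i).nbr_subset (((P i).region_subset u
            ((P i).bag_subset_region u hu)).resolve_left fun hvD => (hD i hvD).2 hv.1)
        obtain ⟨t, ht⟩ := (P i).exists_top v
        have htr : (P i).tree.root = t := (ht _ hvr).resolve_right fun h => h.1 rfl
        have := ((ht u hu).resolve_left fun h' => h (h'.trans htr.symm)).2
        simpa [h] using this
      · have hvD : ∀ i u, v ∈ (P i).bag u → v ∈ D i := fun i u hu =>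
          ((P i).region_subset u ((P i).bag_subset_region u hu)).resolve_right
            fun hvN => hv (hnbr i hvN)
        by_cases hex : ∃ i, v ∈ D i
        · obtain ⟨i, hi⟩ := hex
          obtain ⟨t, ht⟩ := (P i).exists_top v
          refine ⟨some ⟨i, t⟩, ?_⟩
          rintro (_ | ⟨j, u⟩) hu
          · exact absurd hu hv
          obtain rfl := hdisj i j v hi (hvD j u hu)
          rcases ht u hu with rfl | ⟨hur, hup⟩
          · exact Or.inl rfl
          · exact Or.inr ⟨by simp, by simpa [hur] using hup⟩
        · refine ⟨none, ?_⟩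
          rintro (_ | ⟨j, u⟩) hu
          · exact absurd hu hv
          · exact absurd ⟨j, hvD j u hu⟩ hex }

/-- One step of the recursion removes from `C` the vertices covered by `M`, by an edge meeting
`C` and by a balanced separator `S` of these edges. At most `k` of the edges outside `S` touch
the same remaining component, so `2 * k` edges suffice to cover its neighbours. -/
theorem HasSeparators.nonempty_partialDecomposition (hE : (⋃₀ E).Finite) (h : HasSeparators E k)
    {C : Set α} (hC : C ⊆ ⋃₀ E) {M : Set (Set α)} (hM : M ⊆ E) (hMk : M.encard ≤ 2 * k)
    (hMC : nbr E C ⊆ ⋃₀ M) : Nonempty (PartialDecomposition E (3 * k + 1) C) := by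
  induction hn : C.ncard using Nat.strong_induction_on generalizing C M with
  | _ n ih =>
  subst hn
  rcases C.eq_empty_or_nonempty with rfl | ⟨c, hc⟩
  · exact ⟨.glue ∅ (Set.empty_subset _) (by simp) (by rintro x ⟨-, c, hc, -⟩; exact hc.elim)
      (n := 0) (fun _ => ∅) (by simp) (by simp) (by simp) (fun i => i.elim0) (fun i => i.elim0)⟩
  obtain ⟨e, he, hce⟩ := hC hc
  obtain ⟨S, hSE, hSk, hS⟩ := h (insert e M) (Set.insert_subset he hM)
  have hM' : (insert e M).encard ≤ 2 * k + 1 := (Set.encard_insert_le _ _).trans (by gcongr)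
  have hM'f : (insert e M).Finite := by
    refine Set.finite_of_encard_le_coe (k := 2 * k + 1) ?_
    exact_mod_cast hM'
  have hM'n : (insert e M).ncard ≤ 2 * k + 1 := by
    rw [← hM'f.cast_ncard_eq] at hM'
    exact_mod_cast hM'
  set L := insert e M ∪ S with hL
  have hLE : L ⊆ E := Set.union_subset (Set.insert_subset he hM) hSE
  have hML : M ⊆ L := (Set.subset_insert _ _).trans Set.subset_union_left
  have hCL : nbr E C ⊆ ⋃₀ L := hMC.trans (Set.sUnion_subset_sUnion hML)
  have hLw : L.encard ≤ (3 * k + 1 : ℕ) := by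
    refine (Set.encard_union_le _ _).trans ((add_le_add hM' hSk).trans ?_)
    norm_cast
    omega
  let K : Set (Set α) := (fun v => comp E (C \ ⋃₀ L) v) '' (C \ ⋃₀ L)
  have : Finite K := (((hE.subset hC).subset Set.sdiff_subset).image _).to_subtype
  let f := (Finite.equivFin K).symm
  have hf : ∀ i, ∃ v ∈ C \ ⋃₀ L, comp E (C \ ⋃₀ L) v = f i := fun i => (f i).2
  have hsub : ∀ i, (f i : Set α) ⊆ C \ ⋃₀ L := by
    intro i
    obtain ⟨v, hv, hvi⟩ := hf i
    exact hvi ▸ comp_subset hv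
  refine ⟨.glue L hLE hLw hCL (fun i => (f i : Set α)) hsub ?_ ?_ ?_ fun i => Classical.choice ?_⟩
  · intro i a ha b hb hab
    obtain ⟨v, hv, hvi⟩ := hf i
    rw [← hvi] at ha ⊢
    exact mem_comp_of_touch ha hb hab
  · intro v hv
    refine Set.mem_iUnion.2 ⟨f.symm ⟨_, v, hv, rfl⟩, ?_⟩
    rw [f.apply_symm_apply]
    exact mem_comp_self
  · intro i j v hi hj
    obtain ⟨a, ha, hai⟩ := hf i
    obtain ⟨b, hb, hbj⟩ := hf j
    refine f.injective (Subtype.ext ?_)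
    rw [← hai] at hi ⊢
    rw [← hbj] at hj ⊢
    rw [← comp_eq_of_mem ha hi, comp_eq_of_mem hb hj]
  · obtain ⟨v, hv, hvi⟩ := hf i
    have hvS : v ∈ ⋃₀ E \ ⋃₀ S := ⟨hC hv.1, fun h =>
      hv.2 (Set.sUnion_subset_sUnion Set.subset_union_right h)⟩
    have hhalf := hS v hvS
    set T := {m ∈ insert e M | (m ∩ comp E (⋃₀ E \ ⋃₀ S) v).Nonempty} with hT
    have hTsub : T ⊆ insert e M := Set.sep_subset _ _
    have hTk : T.encard ≤ k := by
      rw [← (hM'f.subset hTsub).cast_ncard_eq]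
      have : 2 * T.ncard ≤ (insert e M).ncard := hhalf
      exact_mod_cast (by omega : T.ncard ≤ k)
    have hiS : (f i : Set α) ⊆ comp E (⋃₀ E \ ⋃₀ S) v := by
      rw [← hvi]
      exact comp_mono (Set.sdiff_subset_sdiff hC
        (Set.sUnion_subset_sUnion Set.subset_union_right)) v
    refine ih _ ?_ (M := S ∪ T) ?_ ?_ ?_ ?_ rfl
    · -- the vertex `c` is covered by the edge `e`
      refine Set.ncard_lt_ncard ⟨(hsub i).trans Set.sdiff_subset, fun h => ?_⟩ (hE.subset hC)
      exact (hsub i (h hc)).2 ⟨e, Or.inl (Or.inl rfl), hce⟩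
    · exact ((hsub i).trans Set.sdiff_subset).trans hC
    · exact Set.union_subset hSE (hTsub.trans (Set.insert_subset he hM))
    · refine (Set.encard_union_le _ _).trans ((add_le_add hSk hTk).trans ?_)
      rw [two_mul]
    · rintro x ⟨hxi, d, hd, hdx⟩
      rw [Set.sUnion_union]
      by_cases hxS : x ∈ ⋃₀ S
      · exact Or.inl hxS
      have hxV : x ∈ ⋃₀ E := by
        obtain ⟨e', he', -, hx⟩ := hdx
        exact ⟨e', he', hx⟩
      have hxc : x ∈ comp E (⋃₀ E \ ⋃₀ S) v := mem_comp_of_touch (hiS hd) ⟨hxV, hxS⟩ hdx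
      have hxM : x ∈ ⋃₀ insert e M := by
        by_cases hxC : x ∈ C
        · by_contra hxM
          refine hxi ?_
          rw [← hvi] at hd ⊢
          refine mem_comp_of_touch hd ⟨hxC, ?_⟩ hdx
          rw [hL, Set.sUnion_union]
          exact fun h => h.elim hxM hxS
        · exact Set.sUnion_subset_sUnion (Set.subset_insert _ _)
            (hMC ⟨hxC, d, (hsub i hd).1, hdx⟩)
      obtain ⟨m, hm, hxm⟩ := hxM
      exact Or.inr ⟨m, ⟨hm, x, hxm, hxc⟩, hxm⟩

end EdgeSet

namespace Hypergraph

variable {α : Type*}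

open EdgeSet

/-- The special condition holds because all bags below `u` lie in `region u`, where the edges of
`cover u` contain only vertices of `bag u`. -/
theorem hypertreeWidth_le_of_partialDecomposition {H : Hypergraph α}
    (hV : H.vertexSet = ⋃₀ H.edgeSet) {w : ℕ}
    (P : PartialDecomposition H.edgeSet w H.vertexSet) : H.hypertreeWidth ≤ w := by
  have := P.finite_node
  let D : H.HypertreeDecomposition :=
    { node := P.node
      finite_node := P.finite_node
      tree := P.tree.graph
      isTree := P.tree.isTree
      root := P.tree.root
      bag := P.bag
      bag_subset := fun u => (P.bag_subset_cover u).trans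
        ((Set.sUnion_subset_sUnion (P.cover_subset u)).trans hV.symm.subset)
      cover := P.cover
      cover_subset := P.cover_subset
      connected := fun v _ => by
        obtain ⟨t, ht⟩ := P.exists_top v
        exact ParentTree.induce_preconnected t ht
      exists_edge_subset_bag := fun e he => by
        rcases e.eq_empty_or_nonempty with rfl | ⟨x, hx⟩
        · exact ⟨P.tree.root, Set.empty_subset _⟩
        · exact P.exists_edge_subset_bag e he ⟨x, hx, H.mem_vertexSet_of_mem_edgeSet he hx⟩
      bag_subset_cover := P.bag_subset_cover
      special := fun u => by
        rintro x ⟨hxu, hx⟩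
        obtain ⟨w, ⟨p, hp, hu⟩, hxw⟩ := Set.mem_iUnion₂.1 hx
        exact P.cover_inter_region u ⟨hxu, ParentTree.subset_of_mem_support_of_isPath
          P.region_subset_parent hp hu (P.bag_subset_region w hxw)⟩ }
  exact (iInf_le _ D).trans (iSup_le P.encard_cover_le)

/-- If the vertices outside `j` edges of `H` can be eliminated by nest-sets of size `k`, then the
hypertree width is at most `3 * (k + j) + 1`. -/
theorem hypertreeWidth_le_of_eliminable {H : Hypergraph α} (hfin : H.vertexSet.Finite)
    (hV : H.vertexSet = ⋃₀ H.edgeSet) {J : Set (Set α)} {j k : ℕ} (hJ : J ⊆ H.edgeSet)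
    (hj : J.encard ≤ j) (h : Eliminable H.edgeSet k (H.vertexSet \ ⋃₀ J)) :
    H.hypertreeWidth ≤ (3 * (k + j) + 1 : ℕ) := by
  have hE : H.edgeSet.Finite := hfin.powerset.subset H.edgeSet_subset_powerset_vertexSet
  rw [hV] at h hfin
  obtain ⟨P⟩ := (h.hasSeparators hE hJ hj).nonempty_partialDecomposition hfin (C := H.vertexSet)
    hV.subset (M := ∅) (Set.empty_subset _) (by simp) (by
      rintro x ⟨hx, c, -, e, he, -, hxe⟩
      exact absurd (H.mem_vertexSet_of_mem_edgeSet he hxe) hx)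
  exact hypertreeWidth_le_of_partialDecomposition hV P

/-- A nest-set elimination ordering of `H` eliminates all vertices. The hypergraph obtained from
`H` by some deletions is described by the traces of the edges in `E` on its vertex set. -/
theorem eliminable_of_isNEO {k : ℕ} {l : List (Set α)} {E : Set (Set α)} {H : Hypergraph α}
    (hE : ∀ e ∈ E, (e ∩ H.vertexSet).Nonempty → e ∩ H.vertexSet ∈ H.edgeSet)
    (h : H.IsNEO l) (hk : ∀ s ∈ l, s.encard ≤ k) : Eliminable E k H.vertexSet := by
  induction l generalizing H with
  | nil =>
    obtain rfl : H = ⊥ := h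
    exact .empty
  | cons s l ih =>
    obtain ⟨⟨-, -, hc⟩, hl⟩ := h
    refine .step s (hk s (by simp)) ?_ (ih (H := H.deleteVerts s) ?_ hl
      fun t ht => hk t (by simp [ht]))
    · refine hc.mono ?_
      rintro _ ⟨e, ⟨he, x, hxe, hx⟩, rfl⟩
      refine ⟨e ∩ H.vertexSet, ⟨hE e he ⟨x, hxe, hx.1⟩, x, hx.2, hxe, hx.1⟩, ?_⟩
      exact Set.inter_sdiff_assoc _ _ _
    · intro e he hne
      have hne' : (e ∩ H.vertexSet).Nonempty :=
        hne.mono (Set.inter_subset_inter_right _ Set.sdiff_subset)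
      refine ⟨⟨e ∩ H.vertexSet, hE e he hne', ?_⟩, hne.ne_empty⟩
      change e ∩ H.vertexSet ∩ (H.vertexSet \ s) = e ∩ (H.vertexSet \ s)
      rw [Set.inter_assoc, Set.inter_eq_right.2 Set.sdiff_subset]

/-- Eliminability passes to subhypergraphs, so the bound on the hypertree width applies to each of
them. -/
theorem betaHypertreeWidth_le (H : Hypergraph α) (hfin : H.vertexSet.Finite) :
    H.betaHypertreeWidth ≤ 3 * H.nestSetWidth + 1 := by
  rcases eq_or_ne H.nestSetWidth ⊤ with htop | htop
  · simp [htop]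
  obtain ⟨n, hn⟩ := ENat.ne_top_iff_exists.1 htop
  have hlt : H.nestSetWidth < (n + 1 : ℕ) := by
    rw [← hn]
    exact_mod_cast Nat.lt_succ_self n
  obtain ⟨k, hk⟩ := iInf_lt_iff.1 hlt
  obtain ⟨⟨l, hl, hlk⟩, hkn⟩ := iInf_lt_iff.1 hk
  have hkn' : k ≤ n := Nat.lt_succ_iff.1 (by exact_mod_cast hkn)
  rw [← hn]
  refine iSup₂_le fun H' hH' => ?_
  have hsub : H'.vertexSet ⊆ H.vertexSet := by
    rw [hH'.2]
    exact (Set.sUnion_subset_sUnion hH'.1).trans H.sUnion_edgeSet_subset_vertexSet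
  have hel : Eliminable H.edgeSet k H.vertexSet := by
    refine eliminable_of_isNEO (fun e he _ => ?_) hl hlk
    rwa [Set.inter_eq_left.2 (H.subset_vertexSet_of_mem_edgeSet' he)]
  have := hypertreeWidth_le_of_eliminable (hfin.subset hsub) hH'.2 (J := ∅) (j := 0)
    (Set.empty_subset _) (by simp) (hel.mono hH'.1 (Set.sdiff_subset.trans hsub))
  refine this.trans ?_
  have h2 : 3 * (k + 0) + 1 ≤ 3 * n + 1 := by omega
  exact_mod_cast h2

end Hypergraph

/-! ### Treewidth and clique width of graphs with a cyclic layout -/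

namespace SimpleGraph

variable {V : Type*}

/-- An enumeration of the vertices of a graph by natural numbers below `N` such that neighbours have
consecutive positions, except that the vertex at position `0` may have arbitrary neighbours.
Not all positions need to be used. -/
structure IsCyclicLayout (G : SimpleGraph V) (N : ℕ) (pos : V → ℕ) : Prop where
  injective : Function.Injective pos
  pos_lt : ∀ v, pos v < N
  eq_zero_or_eq_add_one : ∀ u v, G.Adj u v → pos u < pos v → pos u = 0 ∨ pos v = pos u + 1

variable {G : SimpleGraph V} {N : ℕ} {pos : V → ℕ}

/-- The bags along a path consist of the vertices at two consecutive positions, and of the vertex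
at position `0`. -/
theorem IsCyclicLayout.treewidth_le (h : G.IsCyclicLayout N pos) : G.treewidth ≤ 2 := by
  let T : ParentTree (Fin (N + 1)) :=
    { root := 0
      parent := fun t => ⟨t - 1, by omega⟩
      depth := fun t => t
      depth_parent_lt := fun t ht => by
        have : (t : ℕ) ≠ 0 := fun h => ht (Fin.ext h)
        change (t : ℕ) - 1 < t
        omega }
  let D : G.TreeDecomposition :=
    { node := Fin (N + 1)
      finite_node := inferInstance
      tree := T.graph
      isTree := T.isTree
      bag := fun t => {v | pos v = 0 ∨ pos v = t ∨ pos v = t + 1}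
      exists_mem_bag := fun v => ⟨⟨pos v, (h.pos_lt v).trans N.lt_succ_self⟩, by simp⟩
      exists_adj_mem_bag := by
        have key : ∀ u v, G.Adj u v → pos u < pos v → ∃ t : Fin (N + 1),
            (pos u = 0 ∨ pos u = t ∨ pos u = t + 1) ∧ (pos v = 0 ∨ pos v = t ∨ pos v = t + 1) := by
          intro u v huv hlt
          rcases h.eq_zero_or_eq_add_one u v huv hlt with h0 | h1
          · exact ⟨⟨pos v, (h.pos_lt v).trans N.lt_succ_self⟩, by simp [h0]⟩
          · exact ⟨⟨pos u, (h.pos_lt u).trans N.lt_succ_self⟩, by simp [h1]⟩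
        intro u v huv
        rcases lt_trichotomy (pos u) (pos v) with hlt | heq | hlt
        · exact key u v huv hlt
        · exact absurd (h.injective heq) huv.ne
        · obtain ⟨t, h1, h2⟩ := key v u huv.symm hlt
          exact ⟨t, h2, h1⟩
      connected := by
        intro v
        have hv := h.pos_lt v
        refine ParentTree.induce_preconnected ⟨pos v - 1, by omega⟩ ?_
        intro t ht
        have ht' : pos v = 0 ∨ pos v = (t : ℕ) ∨ pos v = t + 1 := ht
        by_cases ht0 : (t : ℕ) = pos v - 1
        · exact Or.inl (Fin.ext ht0)
        · refine Or.inr ⟨fun h0 => ht0 ?_, ?_⟩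
          · have : (t : ℕ) = 0 := congrArg Fin.val h0
            omega
          · change pos v = 0 ∨ pos v = (t : ℕ) - 1 ∨ pos v = (t : ℕ) - 1 + 1
            omega }
  refine (iInf_le _ D).trans (tsub_le_iff_right.2 (iSup_le fun t => ?_))
  have h1 : pos '' D.bag t ⊆ {0, (t : ℕ), (t : ℕ) + 1} := by
    rintro _ ⟨v, hv, rfl⟩
    exact hv
  rw [← (h.injective.injOn (s := D.bag t)).encard_image]
  refine (Set.encard_le_encard h1).trans ((Set.encard_insert_le _ _).trans ?_)
  gcongr
  refine (Set.encard_insert_le _ _).trans ?_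
  rw [Set.encard_singleton]
  norm_num

namespace CliqueExpr

variable {k : ℕ}

/-- The expression `t` builds the graph with vertex set `A`, adjacency relation `R` and labels
`lab`. The values of `R` and `lab` outside `A` are irrelevant. -/
def Builds (t : CliqueExpr k) (A : Set V) (R : V → V → Prop) (lab : V → Fin k) : Prop :=
  ∃ φ : t.Vert → V, Function.Injective φ ∧ Set.range φ = A ∧
    (∀ a b, t.graph.Adj a b ↔ R (φ a) (φ b)) ∧ ∀ a, t.label a = lab (φ a)

variable {t : CliqueExpr k} {A : Set V} {R : V → V → Prop} {lab : V → Fin k}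

theorem Builds.congr (h : t.Builds A R lab) {R' : V → V → Prop} {lab' : V → Fin k}
    (hR : ∀ a ∈ A, ∀ b ∈ A, R a b ↔ R' a b) (hlab : ∀ a ∈ A, lab a = lab' a) :
    t.Builds A R' lab' := by
  obtain ⟨φ, hφ, rfl, hadj, hl⟩ := h
  exact ⟨φ, hφ, rfl, fun a b => (hadj a b).trans (hR _ ⟨a, rfl⟩ _ ⟨b, rfl⟩),
    fun a => (hl a).trans (hlab _ ⟨a, rfl⟩)⟩

open scoped Classical in
theorem Builds.insert (h : t.Builds A R lab) {v : V} (hv : v ∉ A) (i : Fin k) :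
    (t.union (.vertex i)).Builds (insert v A) (fun a b => a ≠ v ∧ b ≠ v ∧ R a b)
      (Function.update lab v i) := by
  obtain ⟨φ, hφ, rfl, hadj, hl⟩ := h
  have hne : ∀ a, φ a ≠ v := fun a ha => hv ⟨a, ha⟩
  let ψ : t.Vert ⊕ Unit → V := Sum.elim φ fun _ => v
  have h1 : Function.Injective ψ :=
    hφ.sumElim (fun a b _ => rfl) fun a b => hne a
  have h2 : Set.range ψ = insert v (Set.range φ) := by
    simp [ψ, Set.Sum.elim_range]
  have h3 : ∀ a b, (SimpleGraph.sum t.graph (⊥ : SimpleGraph Unit)).Adj a b ↔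
      ψ a ≠ v ∧ ψ b ≠ v ∧ R (ψ a) (ψ b) := by
    rintro (a | a) (b | b) <;> simp [ψ, hne, hadj]
  have h4 : ∀ a, Sum.elim t.label (fun _ => i) a = Function.update lab v i (ψ a) := by
    rintro (a | a) <;> simp [ψ, hne, hl]
  exact ⟨ψ, h1, h2, h3, h4⟩

theorem Builds.join (h : t.Builds A R lab) (i j : Fin k) (hij : i ≠ j) :
    (t.join i j hij).Builds A
      (fun a b => R a b ∨ (lab a = i ∧ lab b = j) ∨ (lab b = i ∧ lab a = j)) lab := by
  obtain ⟨φ, hφ, rfl, hadj, hl⟩ := h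
  have key : ∀ a b : t.Vert,
      (t.graph ⊔ SimpleGraph.fromRel fun u v => t.label u = i ∧ t.label v = j).Adj a b ↔
      R (φ a) (φ b) ∨ (lab (φ a) = i ∧ lab (φ b) = j) ∨ (lab (φ b) = i ∧ lab (φ a) = j) := by
    intro a b
    rw [SimpleGraph.sup_adj, SimpleGraph.fromRel_adj, hadj, hl, hl]
    refine or_congr_right ⟨fun h => h.2, fun h => ⟨?_, h⟩⟩
    rintro rfl
    rcases h with h | h <;> exact hij (h.1.symm.trans h.2)
  exact ⟨φ, hφ, rfl, key, hl⟩

theorem Builds.relabel (h : t.Builds A R lab) (i j : Fin k) :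
    (t.relabel i j).Builds A R (fun a => if lab a = i then j else lab a) := by
  obtain ⟨φ, hφ, rfl, hadj, hl⟩ := h
  have key : ∀ a : t.Vert, (if t.label a = i then j else t.label a) =
      if lab (φ a) = i then j else lab (φ a) := fun a => by rw [hl]
  exact ⟨φ, hφ, rfl, hadj, key⟩

theorem Builds.exists_join_if (h : t.Builds A R lab) (i j : Fin k) (hij : i ≠ j) (c : Prop) :
    ∃ t' : CliqueExpr k, t'.Builds A
      (fun a b => R a b ∨ c ∧ ((lab a = i ∧ lab b = j) ∨ (lab b = i ∧ lab a = j))) lab := by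
  by_cases hc : c
  · exact ⟨_, (h.join i j hij).congr (by simp [hc]) (by simp)⟩
  · exact ⟨t, h.congr (by simp [hc]) (by simp)⟩

end CliqueExpr

/-- The vertices are added in the order of their positions. Label `0` marks the vertex at
position `0`, label `1` the last vertex, label `3` a new vertex, and label `2` all others. -/
theorem IsCyclicLayout.exists_builds (h : G.IsCyclicLayout N pos) (m : ℕ) :
    ∃ t : CliqueExpr 4, t.Builds {v | pos v < m} G.Adj
      (fun v => if pos v = 0 then 0 else if pos v + 1 = m then 1 else 2) := by
  classical
  induction m with
  | zero =>
    refine ⟨.empty, (Empty.elim : Empty → V), fun a : Empty => a.elim, ?_,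
      fun a : Empty => a.elim, fun a : Empty => a.elim⟩
    ext v
    exact iff_of_false (fun ⟨a, _⟩ => Empty.elim a) (Nat.not_lt_zero _)
  | succ m ih =>
    obtain ⟨t, ht⟩ := ih
    by_cases hv : ∃ v, pos v = m
    · obtain ⟨v, rfl⟩ := hv
      have hins := ht.insert (v := v) (by simp) 3
      obtain ⟨t₁, h₁⟩ := hins.exists_join_if 3 0 (by decide) (∃ w, pos w = 0 ∧ G.Adj w v)
      obtain ⟨t₂, h₂⟩ := h₁.exists_join_if 3 1 (by decide) (∃ w, pos w + 1 = pos v ∧ G.Adj w v)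
      have h₃ := (h₂.relabel 1 2).relabel 3 (if pos v = 0 then 0 else 1)
      have hset : insert v {u | pos u < pos v} = {u | pos u < pos v + 1} := by
        ext u
        simp only [Set.mem_insert_iff, Set.mem_ofPred_eq, Nat.lt_succ_iff_lt_or_eq,
          ← h.injective.eq_iff (a := u)]
        tauto
      rw [hset] at h₃
      have hpos : ∀ a, pos a < pos v + 1 → a ≠ v → pos a < pos v := fun a ha hav =>
        lt_of_le_of_ne (Nat.le_of_lt_succ ha) (h.injective.ne hav)
      have h0 : ∀ a, pos a = 0 → ((∃ w, pos w = 0 ∧ G.Adj w v) ↔ G.Adj a v) := fun a ha =>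
        ⟨fun ⟨w, hw, hwv⟩ => by rwa [h.injective (ha.trans hw.symm)], fun hav => ⟨a, ha, hav⟩⟩
      have h1 : ∀ a, pos a + 1 = pos v → ((∃ w, pos w + 1 = pos v ∧ G.Adj w v) ↔ G.Adj a v) :=
        fun a ha => ⟨fun ⟨w, hw, hwv⟩ => by
          rwa [h.injective (Nat.succ_injective (ha.trans hw.symm))], fun hav => ⟨a, ha, hav⟩⟩
      have hadj := h.eq_zero_or_eq_add_one
      refine ⟨_, h₃.congr ?_ ?_⟩
      · intro a ha b hb
        have ha' : pos a < pos v + 1 := ha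
        have hb' : pos b < pos v + 1 := hb
        by_cases hav : a = v <;> by_cases hbv : b = v
        · subst hav hbv
          simp
        · subst hav
          have := hpos b hb' hbv
          have := hadj b a
          have := G.adj_comm a b
          have := h0 b
          have := h1 b
          simp only [Function.update_self, Function.update_of_ne hbv]
          grind
        · subst hbv
          have := hpos a ha' hav
          have := hadj a b
          have := h0 a
          have := h1 a
          simp only [Function.update_self, Function.update_of_ne hav]
          grind
        · simp only [Function.update_of_ne hav, Function.update_of_ne hbv]
          grind
      · intro a ha
        by_cases hav : a = v
        · subst hav
          simp only [Function.update_self]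
          split_ifs <;> simp_all
        · have := hpos a ha hav
          simp only [Function.update_of_ne hav]
          grind
    · push Not at hv
      have hset : {u | pos u < m + 1} = {u | pos u < m} := by
        ext u
        have := hv u
        simp only [Set.mem_ofPred_eq]
        omega
      rw [hset]
      refine ⟨_, (ht.relabel 1 2).congr (fun _ _ _ _ => Iff.rfl) fun a ha => ?_⟩
      have ha' : pos a < m := ha
      have := hv a
      grind

theorem IsCyclicLayout.cliqueWidth_le (h : G.IsCyclicLayout N pos) : G.cliqueWidth ≤ 4 := by
  obtain ⟨t, φ, hφ, hr, hadj, -⟩ := h.exists_builds N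
  have hsurj : Function.Surjective φ := fun v => hr.symm.subset (h.pos_lt v)
  refine iInf₂_le 4 ⟨t, ⟨SimpleGraph.Iso.symm ⟨Equiv.ofBijective φ ⟨hφ, hsurj⟩, ?_⟩⟩⟩
  intro a b
  exact (hadj a b).symm

end SimpleGraph

/-! ### Cycles -/

open scoped Fin.CommRing in
/-- Induction around the cycle: a property that is inherited by successors modulo `m + 1` holds
everywhere as soon as it holds somewhere. -/
theorem Fin.induction_add_one {m : ℕ} {P : Fin (m + 1) → Prop} {a : Fin (m + 1)} (ha : P a)
    (h : ∀ i, P i → P (i + 1)) (b : Fin (m + 1)) : P b := by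
  have key : ∀ n : ℕ, P (a + (n : Fin (m + 1))) := by
    intro n
    induction n with
    | zero => simpa using ha
    | succ n ih =>
      have := h _ ih
      rwa [add_assoc, ← Nat.cast_succ] at this
  have := key (b - a : Fin (m + 1)).val
  rwa [Fin.cast_val_eq_self, add_sub_cancel] at this

namespace FiniteHypergraph

open Hypergraph EdgeSet

/-- The hypergraph of `cycle (m + 3)`, with its type of vertices made explicit. -/
abbrev cycleHypergraph (m : ℕ) : Hypergraph (Fin (m + 3)) :=
  ofSimpleGraph (SimpleGraph.cycleGraph (m + 3))

theorem mem_edgeSet_cycle {m : ℕ} {e : Set (Fin (m + 3))} :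
    e ∈ (cycleHypergraph m).edgeSet ↔ ∃ i : Fin (m + 3), e = {i, i + 1} := by
  constructor
  · rintro ⟨u, v, huv, rfl⟩
    rcases SimpleGraph.cycleGraph_adj.1 huv with h | h
    · exact ⟨v, by rw [← h, add_sub_cancel, Set.pair_comm]⟩
    · exact ⟨u, by rw [← h, add_sub_cancel]⟩
  · rintro ⟨i, rfl⟩
    exact ⟨i, i + 1, SimpleGraph.cycleGraph_adj.2 (Or.inr (add_sub_cancel_left _ _)), rfl⟩

theorem val_add_one_eq_or {m : ℕ} (i : Fin (m + 3)) :
    ((i + 1 : Fin (m + 3)) : ℕ) = 0 ∨ ((i + 1 : Fin (m + 3)) : ℕ) = i + 1 := by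
  rw [Fin.val_add_one]
  split_ifs <;> simp

/-- After the removal of vertex `0` a path remains, whose vertices can be eliminated one by one. -/
theorem eliminable_cycle {m : ℕ} (t : ℕ) (ht : 0 < t) :
    Eliminable (cycleHypergraph m).edgeSet 1 {i : Fin (m + 3) | t ≤ i} := by
  induction hn : m + 3 - t generalizing t with
  | zero =>
    have : {i : Fin (m + 3) | t ≤ i} = ∅ := by
      ext i
      exact iff_of_false (fun h : t ≤ (i : ℕ) => by omega) id
    rw [this]
    exact .empty
  | succ n ih =>
    have hX : {i : Fin (m + 3) | t ≤ i} \ {i | (i : ℕ) = t} = {i : Fin (m + 3) | t + 1 ≤ i} := by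
      ext i
      simp only [Set.mem_sdiff, Set.mem_ofPred_eq]
      omega
    refine .step {i | (i : ℕ) = t} ?_ ?_ (by rw [hX]; exact ih (t + 1) (by omega) (by omega))
    · rw [Nat.cast_one, Set.encard_le_one_iff]
      exact fun a b ha hb => Fin.ext (Eq.trans (b := t) ha (Eq.symm hb))
    · rw [hX]
      have key : ∀ e ∈ (cycleHypergraph m).edgeSet,
          (e ∩ ({i : Fin (m + 3) | t ≤ i} ∩ {i | (i : ℕ) = t})).Nonempty →
          e ∩ {i : Fin (m + 3) | t + 1 ≤ i} = ∅ ∨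
            ∃ i : Fin (m + 3), (i : ℕ) = t ∧ e = {i, i + 1} := by
        rintro e he ⟨x, hxe, -, hxt⟩
        obtain ⟨i, rfl⟩ := mem_edgeSet_cycle.1 he
        have hxt' : (x : ℕ) = t := hxt
        have h1 := val_add_one_eq_or i
        rcases hxe with rfl | rfl
        · exact Or.inr ⟨x, hxt, rfl⟩
        · refine Or.inl (Set.eq_empty_iff_forall_notMem.2 ?_)
          rintro y ⟨rfl | rfl, hy⟩
          · have hy' : t + 1 ≤ (y : ℕ) := hy
            omega
          · have hy' : t + 1 ≤ ((i + 1 : Fin (m + 3)) : ℕ) := hy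
            omega
      rintro _ ⟨e, ⟨he, he'⟩, rfl⟩ _ ⟨f, ⟨hf, hf'⟩, rfl⟩ -
      dsimp only
      rcases key e he he' with h | ⟨i, hi, rfl⟩
      · exact Or.inl (h ▸ Set.empty_subset _)
      · rcases key f hf hf' with h | ⟨j, hj, rfl⟩
        · exact Or.inr (h ▸ Set.empty_subset _)
        · rw [Fin.ext (hi.trans hj.symm)]
          exact Or.inl subset_rfl

/-- One edge covers the vertex `0`, and the path that remains is eliminated by single vertices, so
balanced separators consist of two edges. The vertex `0` may be missing in a subhypergraph. -/
theorem betaHw_cycle_le (m : ℕ) : (cycle (m + 3)).betaHw ≤ 7 := by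
  change (cycleHypergraph m).betaHypertreeWidth ≤ (7 : ℕ)
  refine iSup₂_le fun H' hH' => ?_
  have hfin : H'.vertexSet.Finite := Set.toFinite _
  obtain ⟨J, hJ, hJ1, h0⟩ : ∃ J ⊆ H'.edgeSet, J.encard ≤ (1 : ℕ) ∧
      ((0 : Fin (m + 3)) ∈ H'.vertexSet → (0 : Fin (m + 3)) ∈ ⋃₀ J) := by
    by_cases h : (0 : Fin (m + 3)) ∈ H'.vertexSet
    · have h' := h
      rw [hH'.2] at h'
      obtain ⟨e, he, h0⟩ := h'
      exact ⟨{e}, Set.singleton_subset_iff.2 he, by simp, fun _ => ⟨e, rfl, h0⟩⟩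
    · exact ⟨∅, Set.empty_subset _, by simp, fun h' => absurd h' h⟩
  refine hypertreeWidth_le_of_eliminable hfin hH'.2 hJ hJ1 (k := 1) ?_
  refine (eliminable_cycle 1 one_pos).mono hH'.1 fun i hi => ?_
  rcases Nat.eq_zero_or_pos (i : ℕ) with h | h
  · obtain rfl : i = 0 := Fin.ext h
    exact absurd (h0 hi.1) hi.2
  · exact h

/-- A nest-set of a cycle misses at most one vertex: the cycle enters and leaves the nest-set
through the same outside vertex. -/
theorem le_encard_of_isNestSet_cycle {m : ℕ} {s : Set (Fin (m + 3))}
    (hs : (cycleHypergraph m).IsNestSet s) : (m + 2 : ℕ) ≤ s.encard := by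
  obtain ⟨⟨a₀, ha₀⟩, -, hc⟩ := hs
  have huniv : (Set.univ : Set (Fin (m + 3))).encard = (m + 3 : ℕ) := by
    rw [Set.encard_univ, ENat.card_eq_coe_fintype_card, Fintype.card_fin]
  -- any two outside neighbours of `s` coincide
  have key : ∀ a b x y : Fin (m + 3), a ∈ s → b ∈ s → x ∉ s → y ∉ s →
      (x = a + 1 ∨ a = x + 1) → (y = b + 1 ∨ b = y + 1) → x = y := by
    have hedge : ∀ a x : Fin (m + 3), a ∈ s → x ∉ s → (x = a + 1 ∨ a = x + 1) →
        ({x} : Set (Fin (m + 3))) ∈ (fun e => e \ s) '' (cycleHypergraph m).incidentEdges s := by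
      intro a x ha hx hax
      refine ⟨{a, x}, ⟨mem_edgeSet_cycle.2 ?_, a, ha, Or.inl rfl⟩, ?_⟩
      · rcases hax with rfl | rfl
        exacts [⟨a, rfl⟩, ⟨x, Set.pair_comm _ _⟩]
      · ext z
        simp only [Set.mem_sdiff, Set.mem_insert_iff, Set.mem_singleton_iff]
        constructor
        · rintro ⟨rfl | rfl, hz⟩
          exacts [absurd ha hz, rfl]
        · rintro rfl
          exact ⟨Or.inr rfl, hx⟩
    intro a b x y ha hb hx hy hax hby
    rcases hc.total (hedge a x ha hx hax) (hedge b y hb hy hby) with h | h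
    · exact Set.singleton_subset_singleton.1 h
    · exact (Set.singleton_subset_singleton.1 h).symm
  by_cases hall : s = Set.univ
  · rw [hall, huniv]
    exact_mod_cast Nat.le_succ _
  obtain ⟨y₀, hy₀⟩ := (Set.ne_univ_iff_exists_notMem s).1 hall
  obtain ⟨a, ha, ha'⟩ : ∃ a ∈ s, a + 1 ∉ s := by
    by_contra! h
    exact hy₀ (Fin.induction_add_one (P := (· ∈ s)) ha₀ h y₀)
  obtain ⟨y, hy, hy'⟩ : ∃ y, y ∉ s ∧ y + 1 ∈ s := by
    by_contra! h
    exact Fin.induction_add_one (P := (· ∉ s)) hy₀ h a₀ ha₀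
  have hxy : a + 1 = y := key a (y + 1) (a + 1) y ha hy' ha' hy (Or.inl rfl) (Or.inr rfl)
  have hmiss : ∀ b, b ∈ s ∨ b = y := by
    refine Fin.induction_add_one (Or.inl ha) fun i hi => ?_
    rcases hi with hi | rfl
    · by_cases h : i + 1 ∈ s
      · exact Or.inl h
      · exact Or.inr (key i (y + 1) (i + 1) y hi hy' h hy (Or.inl rfl) (Or.inr rfl))
    · exact Or.inl hy'
  have hle : (Set.univ : Set (Fin (m + 3))).encard ≤ s.encard + 1 := by
    refine (Set.encard_le_encard fun b _ => ?_).trans (Set.encard_insert_le s y)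
    exact (hmiss b).symm
  rw [huniv] at hle
  exact (WithTop.add_le_add_iff_right (by simp : (1 : ℕ∞) ≠ ⊤)).1 (by exact_mod_cast hle)

theorem not_bounded_nsw_cycles : ¬ Bounded nsw cycles := by
  rintro ⟨c, hc⟩
  have h := hc (cycle (c + 3)) ⟨c + 3, by omega, rfl⟩
  have hlt : (cycle (c + 3)).graph.nestSetWidth < (c + 1 : ℕ) :=
    lt_of_le_of_lt h (by exact_mod_cast Nat.lt_succ_self c)
  obtain ⟨k, hk⟩ := iInf_lt_iff.1 hlt
  obtain ⟨⟨l, hl, hlk⟩, hkc⟩ := iInf_lt_iff.1 hk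
  have hkc' : k < c + 1 := by exact_mod_cast hkc
  cases l with
  | nil =>
    have h0 : (cycle (c + 3)).graph = ⊥ := hl
    have h1 : (0 : Fin (c + 3)) ∈ (cycle (c + 3)).graph.vertexSet :=
      Set.mem_univ (α := Fin (c + 3)) _
    rw [h0] at h1
    exact h1
  | cons s l =>
    have h1 := (le_encard_of_isNestSet_cycle hl.1).trans (hlk s (by simp))
    have h2 : c + 2 ≤ k := by exact_mod_cast h1
    omega

/-- The edge between the last vertex and vertex `0` is permitted, as `0` has position `0`. -/
theorem primalGraph_cycle_isCyclicLayout (m : ℕ) :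
    (cycleHypergraph m).primalGraph.IsCyclicLayout (m + 3)
      (fun v => (v.1 : Fin (m + 3)).val) where
  injective := fun u v h => Subtype.ext (Fin.ext h)
  pos_lt := fun v => Fin.is_lt _
  eq_zero_or_eq_add_one := by
    rintro ⟨u, _⟩ ⟨v, _⟩ ⟨-, e, he, hu, hv⟩ hlt
    obtain ⟨i, rfl⟩ := mem_edgeSet_cycle.1 he
    have h1 := val_add_one_eq_or i
    dsimp only at hlt hu hv ⊢
    rcases hu with rfl | rfl <;> rcases hv with rfl | rfl
    all_goals omega

/-- The edge `{i, i + 1}` is placed between the vertices `i` and `i + 1`. -/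
theorem exists_incidenceGraph_cycle_isCyclicLayout (m : ℕ) :
    ∃ pos, (cycleHypergraph m).incidenceGraph.IsCyclicLayout (2 * (m + 3)) pos := by
  choose g hg using fun e : (cycleHypergraph m).edgeSet => mem_edgeSet_cycle.1 e.2
  refine ⟨Sum.elim (fun v => 2 * (v.1 : Fin (m + 3)).val) fun e => 2 * (g e).val + 1, ?_, ?_, ?_⟩
  · refine Function.Injective.sumElim (fun u v h => ?_) (fun e f h => ?_) fun u e => ?_
    · exact Subtype.ext (Fin.ext (Nat.eq_of_mul_eq_mul_left two_pos h))
    · refine Subtype.ext ((hg e).trans (Eq.trans ?_ (hg f).symm))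
      rw [Fin.ext (by omega : (g e).val = (g f).val)]
    · omega
  · rintro (v | e)
    · have := (v.1 : Fin (m + 3)).is_lt
      simp only [Sum.elim_inl]
      omega
    · have := (g e).is_lt
      simp only [Sum.elim_inr]
      omega
  · have key : ∀ (v : (cycleHypergraph m).vertexSet) (e : (cycleHypergraph m).edgeSet),
        (v : Fin (m + 3)) ∈ (e : Set (Fin (m + 3))) → (v : Fin (m + 3)).val = 0 ∨
          (v : Fin (m + 3)).val = (g e).val ∨ (v : Fin (m + 3)).val = (g e).val + 1 := by
      intro v e hve
      rw [hg e] at hve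
      have h1 := val_add_one_eq_or (g e)
      rcases hve with h | h
      · exact Or.inr (Or.inl (congrArg Fin.val h))
      · have h' : (v : Fin (m + 3)).val = (g e + 1).val := congrArg Fin.val h
        omega
    intro x y hxy hlt
    rcases ((SimpleGraph.fromRel_adj _ _ _).1 hxy).2 with ⟨v, e, rfl, rfl, h⟩ | ⟨v, e, rfl, rfl, h⟩
    all_goals
      have := key v e h
      simp only [Sum.elim_inl, Sum.elim_inr] at hlt ⊢
      omega

theorem bounded_cycles {w : FiniteHypergraph → ℕ∞} (c : ℕ) (h : ∀ m, w (cycle (m + 3)) ≤ c) :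
    Bounded w cycles := by
  refine ⟨c, ?_⟩
  rintro _ ⟨n, hn, rfl⟩
  obtain ⟨m, rfl⟩ := Nat.exists_eq_add_of_le' hn
  exact h m

theorem bounded_betaHw_of_bounded_nsw {C : Set FiniteHypergraph} (h : Bounded nsw C) :
    Bounded betaHw C := by
  obtain ⟨c, hc⟩ := h
  refine ⟨3 * c + 1, fun H hH => (betaHypertreeWidth_le H.graph H.finite_vertexSet).trans ?_⟩
  have := hc H hH
  push_cast
  gcongr
  exact this

end FiniteHypergraph

theorem theorem4p1 :
    -- the bound
    (∀ (α : Type*) (H : Hypergraph α), H.vertexSet.Finite →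
      H.betaHypertreeWidth ≤ 3 * H.nestSetWidth + 1) ∧
    -- the class of cycles
    (FiniteHypergraph.Bounded FiniteHypergraph.betaHw FiniteHypergraph.cycles ∧
      FiniteHypergraph.Bounded (fun H => H.graph.primalGraph.treewidth) FiniteHypergraph.cycles ∧
      FiniteHypergraph.Bounded (fun H => H.graph.incidenceGraph.treewidth)
        FiniteHypergraph.cycles ∧
      FiniteHypergraph.Bounded (fun H => H.graph.primalGraph.cliqueWidth)
        FiniteHypergraph.cycles ∧
      FiniteHypergraph.Bounded (fun H => H.graph.incidenceGraph.cliqueWidth)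
        FiniteHypergraph.cycles ∧
      ¬ FiniteHypergraph.Bounded FiniteHypergraph.nsw FiniteHypergraph.cycles) ∧
    -- bounded nest-set width is strictly less general than bounded `β`-hypertree width
    ((∀ C : Set FiniteHypergraph,
        FiniteHypergraph.Bounded FiniteHypergraph.nsw C →
          FiniteHypergraph.Bounded FiniteHypergraph.betaHw C) ∧
      ∃ C : Set FiniteHypergraph,
        FiniteHypergraph.Bounded FiniteHypergraph.betaHw C ∧
          ¬ FiniteHypergraph.Bounded FiniteHypergraph.nsw C) := by
  have hβ : FiniteHypergraph.Bounded FiniteHypergraph.betaHw FiniteHypergraph.cycles :=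
    FiniteHypergraph.bounded_cycles 7 FiniteHypergraph.betaHw_cycle_le
  refine ⟨fun α H hH => H.betaHypertreeWidth_le hH, ⟨hβ, ?_, ?_, ?_, ?_,
    FiniteHypergraph.not_bounded_nsw_cycles⟩,
    fun C => FiniteHypergraph.bounded_betaHw_of_bounded_nsw,
    FiniteHypergraph.cycles, hβ, FiniteHypergraph.not_bounded_nsw_cycles⟩
  · exact FiniteHypergraph.bounded_cycles 2 fun m =>
      (FiniteHypergraph.primalGraph_cycle_isCyclicLayout m).treewidth_le
  · refine FiniteHypergraph.bounded_cycles 2 fun m => ?_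
    obtain ⟨pos, hpos⟩ := FiniteHypergraph.exists_incidenceGraph_cycle_isCyclicLayout m
    exact hpos.treewidth_le
  · exact FiniteHypergraph.bounded_cycles 4 fun m =>
      (FiniteHypergraph.primalGraph_cycle_isCyclicLayout m).cliqueWidth_le
  · refine FiniteHypergraph.bounded_cycles 4 fun m => ?_
    obtain ⟨pos, hpos⟩ := FiniteHypergraph.exists_incidenceGraph_cycle_isCyclicLayout m
    exact hpos.cliqueWidth_le
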